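/- Graphs are finite and may have loops and parallel edges. For a graph $G$ let $\Delta(G)=|E(G)|-|V(G)|$, for $X\subseteq E(G)$ let $G\langle X\rangle$ be the subgraph formed by the edges in $X$ and their ends, and let $S(v,G)$ be the set of edges incident to the vertex $v$ (the star of $v$) and $\mathcal S(G)=\{S(v,G):v\in V(G)\}$. For $k\ge 1$ let $M_k(G)$ be the $k$-circular matroid of $G$: the matroid on $E(G)$ whose circuits are the sets $C\subseteq E(G)$ such that $\Delta(G\langle C\rangle)=k$ and $G\langle C\rangle$ has no isolated vertices, no leaves (vertices of degree $1$, a loop counting twice), and no component that is a cycle. A matroid is connected if it has no loops, no coloops, and every two of its elements belong to a common circuit; a cocircuit $K$ of a connected matroid $M$ is non-separating if $M\setminus K$ is connected. Graphs $G$ and $G'$ with $E(G)=E(G')$ are strongly isomorphic if there is a bijection $\nu:V(G)\to V(G')$ such that every edge $e$ has ends $x,y$ in $G$ if and only if it has ends $\nu(x),\nu(y)$ in $G'$. Theorem. Let $k\ge 1$, and let $G$ and $G'$ be finite graphs, where $G'$ has no isolated vertices. Suppose that (a1) $M_k(G)$ is a connected matroid, (a2) every vertex star $S\in\mathcal S(G)$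 is a non-separating cocircuit of $M_k(G)$, and (a3) $M_k(G)=M_k(G')$. Then $\mathcal S(G)=\mathcal S(G')$, and $G$ and $G'$ are strongly isomorphic. -/

import Mathlib

open scoped Graph Matroid

/-! ### Finite multigraphs (loops and parallel edges allowed) -/

namespace Graph

variable {α α' β : Type*}

/-- The degree of a vertex; a loop counts twice. -/
noncomputable def degree (G : Graph α β) (v : α) : ℕ :=
  (G.incidenceSet v).ncard + (G.loopSet v).ncard

/-- `G` is connected: it has a vertex, and any two vertices are joined by a walk. -/
def IsConnected (G : Graph α β) : Prop :=
  V(G).Nonempty ∧ ∀ x ∈ V(G), ∀ y ∈ V(G), Relation.ReflTransGen G.Adj x y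

/-- `G` is a cycle: it is connected and all its degrees are two. (One vertex with a loop and
two vertices joined by two parallel edges are cycles.) -/
def IsCycle (G : Graph α β) : Prop :=
  G.IsConnected ∧ ∀ v ∈ V(G), G.degree v = 2

/-- `K` is a connected component of `G`. -/
def IsComponent (K G : Graph α β) : Prop :=
  K ≤c G ∧ K.IsConnected

/-- A cacti-graph: no isolated vertices, no leaves, no component that is a cycle. -/
def IsCactiGraph (G : Graph α β) : Prop :=
  (∀ v ∈ V(G), ∃ e, G.Inc e v) ∧ (∀ v ∈ V(G), G.degree v ≠ 1) ∧
    ¬ ∃ K : Graph α β, K.IsComponent G ∧ K.IsCycle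

/-- `Δ(G) = |E(G)| - |V(G)|`. -/
noncomputable def Delta (G : Graph α β) : ℤ :=
  (E(G).ncard : ℤ) - V(G).ncard

/-- The set of vertices incident to an edge in `X`. -/
def endSet (G : Graph α β) (X : Set β) : Set α :=
  {v | ∃ e ∈ X, G.Inc e v}

/-- The subgraph `G⟨X⟩` induced by the edge set `X`: its edges are those in `X`, its
vertices are the ends of the edges in `X`. -/
def edgeInduced (G : Graph α β) (X : Set β) : Graph α β where
  vertexSet := G.endSet X
  edgeSet := E(G) ∩ X
  IsLink e x y := e ∈ X ∧ G.IsLink e x y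
  isLink_symm e _ := { symm := fun _ _ h => ⟨h.1, h.2.symm⟩ }
  eq_or_eq_of_isLink_of_isLink _ _ _ _ _ h h' := h.2.left_eq_or_eq h'.2
  edge_mem_iff_exists_isLink e := by
    constructor
    · rintro ⟨h, hX⟩
      obtain ⟨x, y, h⟩ := exists_isLink_of_mem_edgeSet h
      exact ⟨x, y, hX, h⟩
    · rintro ⟨x, y, hX, h⟩
      exact ⟨h.edge_mem, hX⟩
  left_mem_of_isLink e x _ h := ⟨e, h.1, h.2.inc_left⟩

/-- Membership in the family `C_k(G)`: edge sets `C` with `Δ(G⟨C⟩) = k` for which `G⟨C⟩` is a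
cacti-graph. -/
def IsKCircuit (G : Graph α β) (k : ℕ) (C : Set β) : Prop :=
  C ⊆ E(G) ∧ (G.edgeInduced C).Delta = k ∧ (G.edgeInduced C).IsCactiGraph

/-- The set `S(G)` of all vertex stars of `G`. -/
def starSet (G : Graph α β) : Set (Set β) :=
  {S | ∃ v ∈ V(G), S = G.incidenceSet v}

/-- Strong isomorphism: the edge sets coincide and some bijection of the vertex sets preserves
the ends of every edge. -/
def StronglyIsomorphic (G : Graph α β) (G' : Graph α' β) : Prop :=
  E(G) = E(G') ∧ ∃ ν : V(G) ≃ V(G'), ∀ (e : β) (x y : V(G)),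
    G.IsLink e x y ↔ G'.IsLink e (ν x) (ν y)

/-! ### The sets `C_k(G)` are the circuits of a matroid -/

/-- `|X|` minus the number of vertices met by `X`. -/
noncomputable def excess (G : Graph α β) (X : Set β) : ℤ :=
  (X.ncard : ℤ) - (G.endSet X).ncard

theorem endSet_finite (G : Graph α β) {X : Set β} (hX : X.Finite) : (G.endSet X).Finite := by
  have h : G.endSet X = ⋃ e ∈ X, {v | G.Inc e v} := by
    ext v; simp [endSet]
  rw [h]
  refine hX.biUnion fun e _ => ?_
  by_cases he : ∃ x y, G.IsLink e x y
  · obtain ⟨x, y, hxy⟩ := he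
    refine (Set.toFinite {x, y}).subset fun v hv => ?_
    exact Inc.eq_or_eq_of_isLink hv hxy
  · refine Set.finite_empty.subset fun v hv => ?_
    obtain ⟨w, hw⟩ := hv
    exact he ⟨_, _, hw⟩

theorem endSet_mono (G : Graph α β) {X Y : Set β} (h : X ⊆ Y) : G.endSet X ⊆ G.endSet Y :=
  fun _ ⟨e, he, hv⟩ => ⟨e, h he, hv⟩

theorem excess_supermodular (G : Graph α β) {X Y : Set β} (hX : X.Finite) (hY : Y.Finite) :
    G.excess X + G.excess Y ≤ G.excess (X ∪ Y) + G.excess (X ∩ Y) := by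
  have h1 := Set.ncard_union_add_ncard_inter X Y hX hY
  have h2 := Set.ncard_union_add_ncard_inter _ _ (G.endSet_finite hX) (G.endSet_finite hY)
  have h3 : G.endSet (X ∪ Y) = G.endSet X ∪ G.endSet Y := by
    ext v; simp only [endSet, Set.mem_ofPred_eq, Set.mem_union]; grind
  have h4 : (G.endSet (X ∩ Y)).ncard ≤ (G.endSet X ∩ G.endSet Y).ncard :=
    Set.ncard_le_ncard (Set.subset_inter (G.endSet_mono Set.inter_subset_left)
      (G.endSet_mono Set.inter_subset_right)) ((G.endSet_finite hX).inter_of_left _)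
  unfold excess
  rw [h3]
  omega

theorem edgeInduced_delta (G : Graph α β) {X : Set β} (hX : X ⊆ E(G)) :
    (G.edgeInduced X).Delta = G.excess X := by
  unfold Delta excess
  congr 2
  exact congrArg _ (Set.inter_eq_right.2 hX)

/-- Removing a set `D` of edges that contains all edges of `X` at a set `W` of vertices met
by `X`, where `|D| ≤ |W|`, does not decrease the excess. -/
theorem excess_le_excess_sdiff (G : Graph α β) {X D : Set β} {W : Set α} (hX : X.Finite)
    (hDX : D ⊆ X) (hW : W ⊆ G.endSet X) (hD : ∀ e ∈ X, ∀ w ∈ W, G.Inc e w → e ∈ D)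
    (hcard : D.ncard ≤ W.ncard) : G.excess X ≤ G.excess (X \ D) := by
  have h1 := Set.ncard_sdiff_add_ncard_of_subset hDX hX
  have h2 := Set.ncard_sdiff_add_ncard_of_subset hW (G.endSet_finite hX)
  have h3 : (G.endSet (X \ D)).ncard ≤ (G.endSet X \ W).ncard := by
    refine Set.ncard_le_ncard ?_ ((G.endSet_finite hX).subset Set.sdiff_subset)
    rintro v ⟨e, he, hv⟩
    exact ⟨⟨e, he.1, hv⟩, fun hvW => he.2 (hD e he.1 v hvW hv)⟩
  unfold excess
  omega

open scoped Classical in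
/-- The number of ends of `e` (counted with multiplicity) in the set `W`. -/
noncomputable def endCount (H : Graph α β) (W : Finset α) (e : β) : ℕ :=
  ∑ w ∈ W, ((if H.Inc e w then 1 else 0) + (if H.IsLoopAt e w then 1 else 0))

open scoped Classical in
theorem endCount_eq {H : Graph α β} {W : Finset α} {e : β} {x y : α} (h : H.IsLink e x y) :
    H.endCount W e = (if x ∈ W then 1 else 0) + (if y ∈ W then 1 else 0) := by
  have h1 : ∀ w, (if H.Inc e w then 1 else 0) + (if H.IsLoopAt e w then 1 else 0)
      = (if x = w then 1 else 0) + (if y = w then 1 else 0) := by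
    intro w
    have hi : H.Inc e w ↔ x = w ∨ y = w :=
      ⟨fun hw => (hw.eq_or_eq_of_isLink h).imp Eq.symm Eq.symm, by
        rintro (rfl | rfl)
        exacts [h.inc_left, h.inc_right]⟩
    have hl : H.IsLoopAt e w ↔ x = w ∧ y = w :=
      ⟨fun hw => ⟨(hw.eq_of_inc h.inc_left).symm, (hw.eq_of_inc h.inc_right).symm⟩, by
        rintro ⟨rfl, rfl⟩
        exact h⟩
    by_cases hx : x = w <;> by_cases hy : y = w <;> simp [hi, hl, hx, hy]
  unfold endCount
  simp only [h1, Finset.sum_add_distrib, Finset.sum_ite_eq]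

open scoped Classical in
theorem sum_degree (H : Graph α β) (hE : E(H).Finite) (W : Finset α) :
    ∑ w ∈ W, H.degree w = ∑ e ∈ hE.toFinset, H.endCount W e := by
  unfold endCount
  rw [Finset.sum_comm]
  refine Finset.sum_congr rfl fun w _ => ?_
  rw [Finset.sum_add_distrib, Finset.sum_boole, Finset.sum_boole, degree]
  congr 1
  · rw [← Set.ncard_coe_finset]
    simp only [Nat.cast_id]
    congr 1; ext e
    simpa using fun h : H.Inc e w => h.edge_mem
  · rw [← Set.ncard_coe_finset]
    simp only [Nat.cast_id]
    congr 1; ext e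
    simpa using fun h : H.IsLoopAt e w => h.edge_mem

/-- A cycle has as many edges as vertices. -/
theorem IsCycle.ncard_le {K : Graph α β} (hK : K.IsCycle) (hV : V(K).Finite)
    (hE : E(K).Finite) : E(K).ncard ≤ V(K).ncard := by
  classical
  have h := K.sum_degree hE hV.toFinset
  have h1 : ∑ v ∈ hV.toFinset, K.degree v = ∑ v ∈ hV.toFinset, 2 :=
    Finset.sum_congr rfl fun v hv => hK.2 v (by simpa using hv)
  have h2 : ∑ e ∈ hE.toFinset, K.endCount hV.toFinset e = ∑ e ∈ hE.toFinset, 2 := by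
    refine Finset.sum_congr rfl fun e he => ?_
    obtain ⟨x, y, hxy⟩ := exists_isLink_of_mem_edgeSet (hE.mem_toFinset.1 he)
    rw [endCount_eq hxy]
    simp [hxy.left_mem, hxy.right_mem]
  rw [h1, h2] at h
  rw [Set.ncard_eq_toFinset_card _ hV, Set.ncard_eq_toFinset_card _ hE]
  simp only [Finset.sum_const, smul_eq_mul] at h
  omega

/-- If a set `W` of vertices of degree at least two meets at most `|W|` edges, then some
component is a cycle. -/
theorem exists_cycle_component (H : Graph α β) (hE : E(H).Finite) {W : Set α} (hWf : W.Finite)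
    (hWne : W.Nonempty) (hWV : W ⊆ V(H)) (hdeg : ∀ w ∈ W, 2 ≤ H.degree w)
    (hcard : {e | ∃ w ∈ W, H.Inc e w}.ncard ≤ W.ncard) :
    ∃ K : Graph α β, K.IsComponent H ∧ K.IsCycle := by
  classical
  set D : Set β := {e | ∃ w ∈ W, H.Inc e w} with hDdef
  have hDE : D ⊆ E(H) := fun e ⟨w, _, h⟩ => h.edge_mem
  have hDf : D.Finite := hE.subset hDE
  have hle : ∀ e ∈ hE.toFinset, H.endCount hWf.toFinset e ≤ if e ∈ D then 2 else 0 := by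
    intro e he
    obtain ⟨x, y, hxy⟩ := exists_isLink_of_mem_edgeSet (hE.mem_toFinset.1 he)
    rw [endCount_eq hxy]
    by_cases hD : e ∈ D
    · rw [if_pos hD]; split_ifs <;> omega
    · have hx : x ∉ W := fun h => hD ⟨x, h, hxy.inc_left⟩
      have hy : y ∉ W := fun h => hD ⟨y, h, hxy.inc_right⟩
      simp [hx, hy]
  have hsumD : ∑ e ∈ hE.toFinset, (if e ∈ D then 2 else 0) = 2 * D.ncard := by
    rw [← Finset.sum_filter, Finset.sum_const, smul_eq_mul, mul_comm,
      ← Set.ncard_coe_finset]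
    congr 2; ext e
    simpa using fun h => hDE h
  have hsumW : 2 * W.ncard = ∑ w ∈ hWf.toFinset, 2 := by
    rw [Finset.sum_const, smul_eq_mul, mul_comm, Set.ncard_eq_toFinset_card _ hWf]
  have hdeg' : ∀ w ∈ hWf.toFinset, 2 ≤ H.degree w := fun w hw => hdeg w (by simpa using hw)
  have h1 := Finset.sum_le_sum hdeg'
  have h2 := Finset.sum_le_sum hle
  have h3 := H.sum_degree hE hWf.toFinset
  have hdeg2 : ∀ w ∈ W, H.degree w = 2 := by
    have := (Finset.sum_eq_sum_iff_of_le hdeg').1 (by omega)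
    exact fun w hw => (this w (by simpa using hw)).symm
  have hend : ∀ e ∈ D, H.endCount hWf.toFinset e = 2 := by
    have := (Finset.sum_eq_sum_iff_of_le hle).1 (by omega)
    intro e he
    rw [this e (by simpa using hDE he), if_pos he]
  have hclosed : ∀ x y, x ∈ W → H.Adj x y → y ∈ W := by
    rintro x y hx ⟨e, he⟩
    have := hend e ⟨x, hx, he.inc_left⟩
    rw [endCount_eq he] at this
    by_contra hy
    simp [hx, hy] at this
  obtain ⟨w, hw⟩ := hWne
  set U : Set α := {v | Relation.ReflTransGen H.Adj w v} with hU
  have hUW : U ⊆ W := by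
    intro v hv
    induction hv with
    | refl => exact hw
    | tail _ h ih => exact hclosed _ _ ih h
  have hcl : H.induce U ≤c H := by
    refine IsClosedSubgraph.mk' (induce_le (hUW.trans hWV)) fun e x he hx => ?_
    obtain ⟨y, hy⟩ := he
    exact ⟨x, y, hy, hx, Relation.ReflTransGen.tail hx ⟨e, hy⟩⟩
  have hreach : ∀ v ∈ U, Relation.ReflTransGen (H.induce U).Adj w v := by
    intro v hv
    induction hv with
    | refl => exact .refl
    | tail h1 h2 ih =>
      obtain ⟨e, he⟩ := h2
      exact ih.tail ⟨e, he, h1, h1.tail ⟨e, he⟩⟩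
  have hconn : (H.induce U).IsConnected := by
    refine ⟨⟨w, Relation.ReflTransGen.refl⟩, fun x hx y hy => ?_⟩
    have hs : ∀ a b, (H.induce U).Adj a b → (H.induce U).Adj b a :=
      fun a b ⟨e, he⟩ => ⟨e, he.symm⟩
    have h := hreach x hx
    have h' : Relation.ReflTransGen (H.induce U).Adj x w := by
      rw [← Relation.reflTransGen_swap]
      exact Relation.ReflTransGen.mono (fun a b hab => hs a b hab) _ _ h
    exact h'.trans (hreach y hy)
  refine ⟨H.induce U, ⟨hcl, hconn⟩, hconn, fun v hv => ?_⟩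
  rw [← hdeg2 v (hUW hv), degree, degree]
  congr 2
  · ext e
    exact hcl.inc_congr hv
  · ext e
    exact hcl.isLink_congr hv

theorem edgeInduced_inc {G : Graph α β} {X : Set β} {e : β} {v : α} :
    (G.edgeInduced X).Inc e v ↔ e ∈ X ∧ G.Inc e v :=
  ⟨fun ⟨y, h, h'⟩ => ⟨h, y, h'⟩, fun ⟨h, y, h'⟩ => ⟨y, h, h'⟩⟩

/-- Every finite edge set `X` with `|X| - |V(X)| ≥ k ≥ 1` contains a member of `C_k(G)`. -/
theorem exists_isKCircuit (G : Graph α β) {k : ℕ} (hk : 1 ≤ k) {X : Set β} (hX : X.Finite)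
    (hXE : X ⊆ E(G)) (hex : (k : ℤ) ≤ G.excess X) : ∃ C ⊆ X, G.IsKCircuit k C := by
  classical
  obtain ⟨C, hCX, hCmin⟩ : ∃ C ⊆ X, Minimal (fun Y => Y ⊆ X ∧ (k : ℤ) ≤ G.excess Y) C := by
    have hf : {Y | Y ⊆ X ∧ (k : ℤ) ≤ G.excess Y}.Finite :=
      hX.finite_subsets.subset fun Y h => h.1
    exact hf.exists_le_minimal (a := X) ⟨subset_rfl, hex⟩
  have hCf := hX.subset hCX
  have hCE := hCX.trans hXE
  have hmin : ∀ D ⊆ C, D.Nonempty → G.excess (C \ D) < k := by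
    intro D hD hDne
    by_contra! hcon
    have := hCmin.2 ⟨Set.sdiff_subset.trans hCX, hcon⟩ Set.sdiff_subset
    obtain ⟨e, he⟩ := hDne
    exact (this (hD he)).2 he
  have hdrop : ∀ (D : Set β) (W : Set α), D ⊆ C → D.Nonempty → W ⊆ G.endSet C →
      (∀ e ∈ C, ∀ w ∈ W, G.Inc e w → e ∈ D) → D.ncard ≤ W.ncard → False := by
    intro D W hD hDne hW hDW hc
    have := G.excess_le_excess_sdiff hCf hD hW hDW hc
    have := hmin D hD hDne
    have := hCmin.1.2
    omega
  refine ⟨C, hCX, hCE, ?_, ?_, ?_, ?_⟩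
  · rw [G.edgeInduced_delta hCE]
    refine le_antisymm ?_ hCmin.1.2
    have hne : C.Nonempty := by
      by_contra h
      rw [Set.not_nonempty_iff_eq_empty] at h
      have := hCmin.1.2
      simp [h, excess, endSet] at this
      omega
    obtain ⟨e, he⟩ := hne
    have h1 := hmin {e} (by simpa using he) (by simp)
    have h2 := Set.ncard_sdiff_singleton_add_one he hCf
    have h3 : (G.endSet (C \ {e})).ncard ≤ (G.endSet C).ncard :=
      Set.ncard_le_ncard (G.endSet_mono Set.sdiff_subset) (G.endSet_finite hCf)
    unfold excess at *
    omega
  · rintro v ⟨e, he, hv⟩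
    exact ⟨e, edgeInduced_inc.2 ⟨he, hv⟩⟩
  · rintro v ⟨e, he, hv⟩ hdeg
    have hfin : ((G.edgeInduced C).incidenceSet v).Finite :=
      hCf.subset fun f hf => (edgeInduced_inc.1 hf).1
    have hmem : e ∈ (G.edgeInduced C).incidenceSet v := edgeInduced_inc.2 ⟨he, hv⟩
    have hpos := (Set.ncard_pos hfin).2 ⟨e, hmem⟩
    refine hdrop ((G.edgeInduced C).incidenceSet v) {v}
      (fun f hf => (edgeInduced_inc.1 hf).1) ⟨e, hmem⟩ ?_ ?_ ?_
    · rintro _ rfl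
      exact ⟨e, he, hv⟩
    · rintro f hf _ rfl hfw
      exact edgeInduced_inc.2 ⟨hf, hfw⟩
    · rw [Set.ncard_singleton]
      unfold degree at hdeg
      omega
  · rintro ⟨K, ⟨hKc, hKne, -⟩, hKcyc⟩
    have hVK : V(K) ⊆ G.endSet C := hKc.le.vertexSet_mono
    have hEK : E(K) ⊆ C := fun e he => (hKc.le.edgeSet_mono he).2
    have hEC : ∀ e ∈ C, ∀ w ∈ V(K), G.Inc e w → e ∈ E(K) :=
      fun e he w hw hew => hKc.closed (edgeInduced_inc.2 ⟨he, hew⟩) hw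
    refine hdrop E(K) V(K) hEK ?_ hVK hEC
      (hKcyc.ncard_le ((G.endSet_finite hCf).subset hVK) (hCf.subset hEK))
    obtain ⟨w, hw⟩ := hKne
    obtain ⟨e, he, hew⟩ := hVK hw
    exact ⟨e, hEC e he w hw hew⟩

/-- Proper subsets of a member of `C_k(G)` have smaller excess. -/
theorem IsKCircuit.excess_lt {G : Graph α β} {k : ℕ} {C : Set β} (hC : G.IsKCircuit k C)
    (hCf : C.Finite) {Y : Set β} (hY : Y ⊂ C) : G.excess Y < k := by
  obtain ⟨hCE, hdel, hiso, hleaf, hcyc⟩ := hC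
  rw [G.edgeInduced_delta hCE] at hdel
  by_contra! hcon
  have hYC := hY.subset
  have hcard := Set.ncard_lt_ncard hY hCf
  have h1 := Set.ncard_sdiff_add_ncard_of_subset hYC hCf
  have h2 := Set.ncard_sdiff_add_ncard_of_subset (G.endSet_mono hYC) (G.endSet_finite hCf)
  unfold excess at *
  have hWf : (G.endSet C \ G.endSet Y).Finite := (G.endSet_finite hCf).subset Set.sdiff_subset
  refine hcyc ((G.edgeInduced C).exists_cycle_component (hCf.subset Set.inter_subset_right)
    hWf ?_ Set.sdiff_subset ?_ ?_)
  · rw [← Set.ncard_pos hWf]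
    omega
  · intro w hw
    have ha := hleaf w hw.1
    obtain ⟨e, he⟩ := hiso w hw.1
    have hfin : ((G.edgeInduced C).incidenceSet w).Finite :=
      hCf.subset fun f hf => (edgeInduced_inc.1 hf).1
    have hpos := (Set.ncard_pos hfin).2 ⟨e, he⟩
    unfold degree at *
    omega
  · refine (Set.ncard_le_ncard (t := C \ Y) ?_ (hCf.subset Set.sdiff_subset)).trans (by omega)
    rintro e ⟨w, hw, hew⟩
    have := edgeInduced_inc.1 hew
    exact ⟨this.1, fun heY => hw.2 ⟨e, heY, this.2⟩⟩

/-- A subset of `E(G)` that contains no member of `C_k(G)`. -/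
def KIndep (G : Graph α β) (k : ℕ) (I : Set β) : Prop :=
  I ⊆ E(G) ∧ ∀ C, G.IsKCircuit k C → ¬ C ⊆ I

theorem kIndep_iff (G : Graph α β) {k : ℕ} (hk : 1 ≤ k) (hE : E(G).Finite) {I : Set β} :
    G.KIndep k I ↔ I ⊆ E(G) ∧ ∀ Y ⊆ I, G.excess Y < k := by
  refine and_congr_right fun hI => ⟨fun h Y hY => ?_, fun h C hC hCI => ?_⟩
  · by_contra! hcon
    obtain ⟨C, hCY, hC⟩ := G.exists_isKCircuit hk (hE.subset (hY.trans hI)) (hY.trans hI) hcon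
    exact h C hC (hCY.trans hY)
  · have := h C hCI
    rw [← G.edgeInduced_delta hC.1, hC.2.1] at this
    exact lt_irrefl _ this

theorem KIndep.augment {G : Graph α β} {k : ℕ} (hk : 1 ≤ k) (hE : E(G).Finite) {I J : Set β}
    (hI : G.KIndep k I) (hJ : G.KIndep k J) (hIJ : I.ncard < J.ncard) :
    ∃ e ∈ J, e ∉ I ∧ G.KIndep k (insert e I) := by
  classical
  rw [G.kIndep_iff hk hE] at hI hJ
  by_contra! hcon
  have hIf := hE.subset hI.1
  have hJf := hE.subset hJ.1
  -- a tight subset of `I` for every edge of `J` outside `I`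
  have htight : ∀ e ∈ J, e ∉ I → ∃ T ⊆ I, (k : ℤ) ≤ G.excess T + 1 ∧
      ∀ v, G.Inc e v → v ∈ G.endSet T := by
    intro e heJ heI
    have h := hcon e heJ heI
    rw [G.kIndep_iff hk hE, not_and] at h
    have h := h (Set.insert_subset (hJ.1 heJ) hI.1)
    push Not at h
    obtain ⟨Y, hY, hYk⟩ := h
    have heY : e ∈ Y := by
      by_contra heY
      have := hI.2 Y ((Set.subset_insert_iff_of_notMem heY).1 hY)
      omega
    have hYf : Y.Finite := (hIf.insert e).subset hY
    have hTI : Y \ {e} ⊆ I := by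
      rintro f ⟨hf, hfe⟩
      exact (hY hf).resolve_left hfe
    have h1 := Set.ncard_sdiff_singleton_add_one heY hYf
    have hsub : G.endSet (Y \ {e}) ⊆ G.endSet Y := G.endSet_mono Set.sdiff_subset
    have h2 := Set.ncard_le_ncard hsub (G.endSet_finite hYf)
    have h3 := hI.2 _ hTI
    unfold excess at *
    refine ⟨Y \ {e}, hTI, by omega, fun v hv => ?_⟩
    have heq := Set.eq_of_subset_of_ncard_le hsub (by omega) (G.endSet_finite hYf)
    rw [heq]
    exact ⟨e, heY, hv⟩
  obtain ⟨e₀, he₀J, he₀I⟩ : ∃ e ∈ J, e ∉ I := by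
    by_contra! h
    exact absurd (Set.ncard_le_ncard h hIf) (by omega)
  obtain ⟨T₀, hT₀I, hT₀, -⟩ := htight e₀ he₀J he₀I
  -- a largest tight subset of `I`
  obtain ⟨T, hT⟩ : ∃ T, Maximal (fun T => T ⊆ I ∧ (k : ℤ) ≤ G.excess T + 1) T := by
    have hf : {T | T ⊆ I ∧ (k : ℤ) ≤ G.excess T + 1}.Finite :=
      hIf.finite_subsets.subset fun T h => h.1
    obtain ⟨T, -, hT⟩ := hf.exists_le_maximal (a := T₀) ⟨hT₀I, hT₀⟩
    exact ⟨T, hT⟩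
  have hTI : T ⊆ I := hT.1.1
  have hTf := hIf.subset hTI
  have hall : ∀ e ∈ J, e ∉ I → ∀ v, G.Inc e v → v ∈ G.endSet T := by
    intro e heJ heI v hv
    obtain ⟨T', hT'I, hT', hT'v⟩ := htight e heJ heI
    have h1 := G.excess_supermodular hTf (hIf.subset hT'I)
    have h2 := hI.2 (T ∩ T') (Set.inter_subset_left.trans hTI)
    have h3 := hT.1.2
    have h4 : T ∪ T' ⊆ T := hT.2 ⟨Set.union_subset hTI hT'I, by omega⟩ Set.subset_union_left
    exact G.endSet_mono (Set.subset_union_right.trans h4) (hT'v v hv)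
  have hsub : G.endSet ((J \ I) ∪ (J ∩ T)) ⊆ G.endSet T := by
    rintro v ⟨e, he | he, hv⟩
    · exact hall e he.1 he.2 v hv
    · exact ⟨e, he.2, hv⟩
  have h1 := hJ.2 ((J \ I) ∪ (J ∩ T)) (Set.union_subset Set.sdiff_subset Set.inter_subset_left)
  have h2 := Set.ncard_le_ncard hsub (G.endSet_finite hTf)
  have h3 := hT.1.2
  have h4 : ((J \ I) ∪ (J ∩ T)).ncard = (J \ I).ncard + (J ∩ T).ncard :=
    Set.ncard_union_eq (Set.disjoint_left.2 fun e he he' => he.2 (hTI he'.2))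
      (hJf.subset Set.sdiff_subset) (hJf.subset Set.inter_subset_left)
  have h5 : (J ∩ I).ncard + (J \ I).ncard = J.ncard := Set.ncard_inter_add_ncard_sdiff_eq_ncard J I hJf
  have h6 : (T ∩ J).ncard + (T \ J).ncard = T.ncard := Set.ncard_inter_add_ncard_sdiff_eq_ncard T J hTf
  have h7 : (I ∩ J).ncard + (I \ J).ncard = I.ncard := Set.ncard_inter_add_ncard_sdiff_eq_ncard I J hIf
  have h8 : (T \ J).ncard ≤ (I \ J).ncard :=
    Set.ncard_le_ncard (Set.sdiff_subset_sdiff_left hTI) (hIf.subset Set.sdiff_subset)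
  rw [Set.inter_comm J I] at h5
  rw [Set.inter_comm T J] at h6
  unfold excess at *
  rw [h4] at h1
  omega

/-- The `k`-circular matroid `M_k(G)` of a graph `G` with finitely many edges, for `k ≥ 1`: the
matroid on `E(G)` whose circuits are the members of `C_k(G)` (see `isCircuit_kCircularMatroid`),
that is, whose independent sets are the sets of edges containing no member of `C_k(G)`. -/
noncomputable def kCircularMatroid (G : Graph α β) (k : ℕ) (hk : 1 ≤ k) (hE : E(G).Finite) :
    Matroid β :=
  (IndepMatroid.ofFinite hE (G.KIndep k)
    ((G.kIndep_iff hk hE).2 ⟨Set.empty_subset _, fun Y hY => by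
      rw [Set.subset_empty_iff.1 hY]
      simp [excess, endSet]
      omega⟩)
    (fun _ _ hJ hIJ => ⟨hIJ.trans hJ.1, fun C hC h => hJ.2 C hC (h.trans hIJ)⟩)
    (fun _ _ hI hJ h => hI.augment hk hE hJ h)
    (fun _ hI => hI.1)).matroid

theorem kCircularMatroid_ground (G : Graph α β) {k : ℕ} (hk : 1 ≤ k) (hE : E(G).Finite) :
    (G.kCircularMatroid k hk hE).E = E(G) := rfl

theorem kCircularMatroid_indep_iff (G : Graph α β) {k : ℕ} (hk : 1 ≤ k) (hE : E(G).Finite)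
    {I : Set β} : (G.kCircularMatroid k hk hE).Indep I ↔ G.KIndep k I := Iff.rfl

/-- The circuits of `M_k(G)` are exactly the members of `C_k(G)`. -/
theorem isCircuit_kCircularMatroid (G : Graph α β) {k : ℕ} (hk : 1 ≤ k) (hE : E(G).Finite)
    {C : Set β} : (G.kCircularMatroid k hk hE).IsCircuit C ↔ G.IsKCircuit k C := by
  rw [Matroid.isCircuit_iff_forall_ssubset]
  constructor
  · rintro ⟨hdep, hmin⟩
    have hCE : C ⊆ E(G) := hdep.subset_ground
    have h : ¬ G.KIndep k C := hdep.not_indep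
    unfold KIndep at h
    push Not at h
    obtain ⟨D, hD, hDC⟩ := h hCE
    obtain rfl | hss := hDC.eq_or_ssubset
    · exact hD
    · exact absurd subset_rfl ((hmin hss).2 D hD)
  · intro hC
    refine ⟨⟨fun h => h.2 C hC subset_rfl, hC.1⟩, fun D hDC => ?_⟩
    refine (G.kIndep_iff hk hE).2 ⟨hDC.subset.trans hC.1, fun Y hY => ?_⟩
    exact hC.excess_lt (hE.subset hC.1) (hY.trans_ssubset hDC)

end Graph

namespace Matroid

variable {β : Type*}

/-- A matroid is connected if it has no loops, no coloops, and every two elements belong to a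
common circuit. -/
def IsConnected (M : Matroid β) : Prop :=
  (∀ e, ¬ M.IsLoop e) ∧ (∀ e, ¬ M.IsColoop e) ∧
    ∀ e ∈ M.E, ∀ f ∈ M.E, e ≠ f → ∃ C, M.IsCircuit C ∧ e ∈ C ∧ f ∈ C

/-- A non-separating cocircuit of a (connected) matroid `M`: a cocircuit whose deletion leaves
a connected matroid. -/
def IsNonseparatingCocircuit (M : Matroid β) (K : Set β) : Prop :=
  M.IsCocircuit K ∧ (M ＼ K).IsConnected

end Matroid

/-! ### Rank of edge sets without coloops -/

namespace Graph

variable {α β : Type*}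

/-! The rank function of the `k`-circular matroid counts vertices. A nonempty edge set `X`, every
element of which lies on a circuit inside `X`, has rank `|V(X)| + k - 1`, where `V(X)` is the set of
vertices met by `X` (`ncard_isBasis_of_forall_mem_isCircuit`). For a connected matroid and a graph
with nonempty edge set and no isolated vertices, the total rank is therefore `|V| + k - 1`, so the
common matroid forces `G` and `G'` to have equally many vertices.

Let `K` be a non-separating cocircuit. Its complement `H` has rank one less than the matroid and, if
nonempty, has no coloops, so it meets all vertices but one, say `v`. Every edge at `v` then lies in
`K`. Conversely, an edge of `K` avoiding `v` could be added to `H` without meeting a new vertex, so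
the rank could not rise, although `H` is a hyperplane. Hence `K` is the star of `v`.

Applied to `G'`, this makes every star of `G` a star of `G'`; applied to `G`, it shows that distinct
vertices have distinct stars. The resulting injection of vertex sets is a bijection by cardinality,
and it preserves incidence, which determines the ends of every edge. -/

theorem KIndep.ncard_le {G : Graph α β} {k : ℕ} (hk : 1 ≤ k) (hE : E(G).Finite) {I Y : Set β}
    (hI : G.KIndep k I) (hIY : I ⊆ Y) (hY : Y ⊆ E(G)) :
    (I.ncard : ℤ) ≤ (G.endSet Y).ncard + k - 1 := by
  have h1 := ((G.kIndep_iff hk hE).1 hI).2 I subset_rfl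
  have h2 := Set.ncard_le_ncard (G.endSet_mono hIY) (G.endSet_finite (hE.subset hY))
  unfold excess at h1
  omega

/-- In a `k`-circuit every edge can be removed without losing a vertex, and what remains is
tight. -/
theorem IsKCircuit.sdiff_singleton {G : Graph α β} {k : ℕ} {C : Set β} (hC : G.IsKCircuit k C)
    (hCf : C.Finite) {e : β} (he : e ∈ C) :
    (k : ℤ) ≤ G.excess (C \ {e}) + 1 ∧ ∀ v, G.Inc e v → v ∈ G.endSet (C \ {e}) := by
  have h1 := Set.ncard_sdiff_singleton_add_one he hCf
  have hsub : G.endSet (C \ {e}) ⊆ G.endSet C := G.endSet_mono Set.sdiff_subset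
  have h2 := Set.ncard_le_ncard hsub (G.endSet_finite hCf)
  -- The excess falls by at least one when `e` is removed, and the loss of the edge itself accounts
  -- for exactly one; so no vertex is lost.
  have h3 := hC.excess_lt hCf (Set.sdiff_singleton_ssubset.2 he)
  have h4 := hC.2.1
  rw [G.edgeInduced_delta hC.1] at h4
  unfold excess at *
  refine ⟨by omega, fun v hv => ?_⟩
  rw [Set.eq_of_subset_of_ncard_le hsub (by omega) (G.endSet_finite hCf)]
  exact ⟨e, he, hv⟩

/-- A nonempty edge set `X` without coloops in `M_k(G) | X` has rank `|V(X)| + k - 1`. -/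
theorem ncard_isBasis_of_forall_mem_isCircuit (G : Graph α β) {k : ℕ} (hk : 1 ≤ k)
    (hE : E(G).Finite) {I X : Set β} (hIX : (G.kCircularMatroid k hk hE).IsBasis I X)
    (hXne : X.Nonempty)
    (hX : ∀ f ∈ X, ∃ C ⊆ X, (G.kCircularMatroid k hk hE).IsCircuit C ∧ f ∈ C) :
    (I.ncard : ℤ) = (G.endSet X).ncard + k - 1 := by
  classical
  set M := G.kCircularMatroid k hk hE with hM
  have hXE : X ⊆ E(G) := hIX.subset_ground
  have hIk : G.KIndep k I := hIX.indep
  have hI := (G.kIndep_iff hk hE).1 hIk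
  have hIf := hE.subset hI.1
  have hIsub := hIX.subset
  -- a tight subset of `I` for every edge of `X` outside `I`
  have htight : ∀ e ∈ X, e ∉ I → ∃ T ⊆ I, (k : ℤ) ≤ G.excess T + 1 ∧
      ∀ v, G.Inc e v → v ∈ G.endSet T := by
    intro e heX heI
    obtain ⟨C, hCI, hC⟩ := (hIX.insert_dep ⟨heX, heI⟩).exists_isCircuit_subset
    have heC : e ∈ C := by
      by_contra h
      exact hC.not_indep (hIX.indep.subset ((Set.subset_insert_iff_of_notMem h).1 hCI))
    have hC' := (G.isCircuit_kCircularMatroid hk hE).1 hC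
    exact ⟨C \ {e}, fun f hf => (hCI hf.1).resolve_left hf.2,
      hC'.sdiff_singleton (hE.subset hC'.1) heC⟩
  obtain ⟨e₀, he₀X, he₀I⟩ : ∃ e ∈ X, e ∉ I := by
    by_contra! h
    obtain ⟨f, hf⟩ := hXne
    obtain ⟨C, hCX, hC, -⟩ := hX f hf
    exact hC.not_indep (hIX.indep.subset (hCX.trans h))
  obtain ⟨T₀, hT₀I, hT₀, -⟩ := htight e₀ he₀X he₀I
  -- Tight sets have excess exactly `k - 1`, the most that independence allows. By supermodularity
  -- they are closed under union, so a maximal one contains them all.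
  obtain ⟨T, hT⟩ : ∃ T, Maximal (fun T => T ⊆ I ∧ (k : ℤ) ≤ G.excess T + 1) T := by
    have hf : {T | T ⊆ I ∧ (k : ℤ) ≤ G.excess T + 1}.Finite :=
      hIf.finite_subsets.subset fun T h => h.1
    obtain ⟨T, -, hT⟩ := hf.exists_le_maximal (a := T₀) ⟨hT₀I, hT₀⟩
    exact ⟨T, hT⟩
  have hTI : T ⊆ I := hT.1.1
  have hTf := hIf.subset hTI
  have hall : ∀ e ∈ X, e ∉ I → ∀ v, G.Inc e v → v ∈ G.endSet T := by
    intro e heX heI v hv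
    obtain ⟨T', hT'I, hT', hT'v⟩ := htight e heX heI
    have h1 := G.excess_supermodular hTf (hIf.subset hT'I)
    have h2 := hI.2 (T ∩ T') (Set.inter_subset_left.trans hTI)
    have h3 := hT.1.2
    have h4 : T ∪ T' ⊆ T := hT.2 ⟨Set.union_subset hTI hT'I, by omega⟩ Set.subset_union_left
    exact G.endSet_mono (Set.subset_union_right.trans h4) (hT'v v hv)
  -- Adding `e` to `T` meets no new vertex, so the excess rises to `k` and the set becomes
  -- dependent.
  have hTcl : ∀ e ∈ X, e ∉ I → e ∈ M.closure T := by
    intro e heX heI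
    have heT : e ∉ T := fun h => heI (hTI h)
    rw [(hIX.indep.subset hTI).mem_closure_iff_of_notMem heT]
    refine ⟨fun hind => ?_, Set.insert_subset (hXE heX) (hTI.trans hI.1)⟩
    have h := ((G.kIndep_iff hk hE).1 hind).2 _ subset_rfl
    have hend : G.endSet (insert e T) = G.endSet T := by
      refine Set.Subset.antisymm ?_ (G.endSet_mono (Set.subset_insert _ _))
      rintro v ⟨f, rfl | hf, hv⟩
      · exact hall f heX heI v hv
      · exact ⟨f, hf, hv⟩
    have h3 := hT.1.2
    unfold excess at *
    rw [hend, Set.ncard_insert_of_notMem heT hTf] at h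
    push_cast at h
    omega
  -- The absence of coloops enters here: for `f` in `I` outside `T`, the rest of a circuit through
  -- `f` is spanned by `I \ {f}`, so `f` would be too.
  have hIT : I = T := by
    refine Set.Subset.antisymm (fun f hfI => ?_) hTI
    by_contra hfT
    obtain ⟨C, hCX, hC, hfC⟩ := hX f (hIsub hfI)
    have hsub : C \ {f} ⊆ M.closure (I \ {f}) := by
      rintro e ⟨he, hef⟩
      by_cases heI : e ∈ I
      · exact M.mem_closure_of_mem ⟨heI, hef⟩ (Set.sdiff_subset.trans hI.1)
      · exact M.closure_subset_closure (Set.subset_sdiff_singleton hTI hfT)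
          (hTcl e (hCX he) heI)
    exact hIX.indep.notMem_closure_sdiff_of_mem hfI
      (M.closure_subset_closure_of_subset_closure hsub
        (hC.mem_closure_sdiff_singleton_of_mem hfC))
  have hend : G.endSet X = G.endSet I := by
    refine Set.Subset.antisymm ?_ (G.endSet_mono hIsub)
    rintro v ⟨f, hf, hv⟩
    by_cases hfI : f ∈ I
    · exact ⟨f, hfI, hv⟩
    · rw [hIT]
      exact hall f hf hfI v hv
  have h1 := hI.2 I subset_rfl
  have h2 := hT.1.2
  rw [← hIT] at h2
  rw [hend]
  unfold excess at *
  omega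

/-! ### Stars as non-separating cocircuits -/

theorem endSet_edgeSet {G : Graph α β} (hiso : ∀ v ∈ V(G), ∃ e, G.Inc e v) :
    G.endSet E(G) = V(G) :=
  Set.Subset.antisymm (fun _ ⟨_, _, h⟩ => h.vertex_mem) fun v hv =>
    let ⟨e, he⟩ := hiso v hv
    ⟨e, he.edge_mem, he⟩

theorem ncard_isBase_of_isConnected (G : Graph α β) {k : ℕ} (hk : 1 ≤ k) (hE : E(G).Finite)
    (hiso : ∀ v ∈ V(G), ∃ e, G.Inc e v) (hne : E(G).Nonempty)
    (hconn : (G.kCircularMatroid k hk hE).IsConnected) {B : Set β}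
    (hB : (G.kCircularMatroid k hk hE).IsBase B) : (B.ncard : ℤ) = V(G).ncard + k - 1 := by
  rw [← endSet_edgeSet hiso]
  refine G.ncard_isBasis_of_forall_mem_isCircuit hk hE hB.isBasis_ground hne fun f hf => ?_
  have h := hconn.2.1 f
  rw [Matroid.isColoop_iff_forall_notMem_isCircuit hf] at h
  push Not at h
  obtain ⟨C, hC, hfC⟩ := h
  exact ⟨C, hC.subset_ground, hC, hfC⟩

/-- The complement of a nonseparating cocircuit of a connected `M_k(G)` misses exactly one
vertex, and the cocircuit is the star of that vertex. -/
theorem exists_eq_incidenceSet_of_isNonseparatingCocircuit (G : Graph α β) {k : ℕ} (hk : 1 ≤ k)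
    (hV : V(G).Finite) (hE : E(G).Finite) (hiso : ∀ v ∈ V(G), ∃ e, G.Inc e v)
    (hconn : (G.kCircularMatroid k hk hE).IsConnected) {K : Set β}
    (hK : (G.kCircularMatroid k hk hE).IsNonseparatingCocircuit K) :
    ∃ v, V(G) \ G.endSet (E(G) \ K) = {v} ∧ K = G.incidenceSet v := by
  set M := G.kCircularMatroid k hk hE with hM
  set H := E(G) \ K with hH
  obtain ⟨hKc, hdel⟩ := hK
  have hHE : H ⊆ E(G) := Set.sdiff_subset
  have hKE : K ⊆ E(G) := hKc.subset_ground
  have hmin := Matroid.isCocircuit_iff_minimal_compl_nonspanning.1 hKc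
  have hHns : ¬ M.Spanning H := hmin.1
  -- By minimality of the cocircuit, `H` is a hyperplane: any further element makes it spanning.
  have hspan : ∀ e ∈ K, M.Spanning (insert e H) := by
    intro e he
    by_contra hcon
    have heq : insert e H = M.E \ (K \ {e}) := by
      ext f
      change _ ↔ f ∈ E(G) ∧ _
      have := hKE he
      simp only [hH, Set.mem_insert_iff, Set.mem_sdiff, Set.mem_singleton_iff]
      grind
    rw [heq] at hcon
    exact (hmin.2 hcon Set.sdiff_subset he).2 rfl
  obtain ⟨e₀, he₀⟩ := hKc.nonempty
  obtain ⟨I, hI⟩ := M.exists_isBasis H hHE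
  have hIf : I.Finite := hE.subset (hI.subset.trans hHE)
  have hbase : ∀ {B}, M.IsBase B → (B.ncard : ℤ) = V(G).ncard + k - 1 :=
    fun hB => G.ncard_isBase_of_isConnected hk hE hiso ⟨e₀, hKE he₀⟩ hconn hB
  have hendV : G.endSet H ⊆ V(G) := fun _ ⟨_, _, h⟩ => h.vertex_mem
  have hlt : (I.ncard : ℤ) < V(G).ncard + k - 1 := by
    obtain ⟨B, hB, hIB⟩ := hI.indep.exists_isBase_superset
    rw [← hbase hB, Nat.cast_lt]
    refine Set.ncard_lt_ncard (hIB.ssubset_of_ne ?_) (hE.subset hB.subset_ground)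
    rintro rfl
    exact hHns (hB.spanning.superset hI.subset hHE)
  have hge : (V(G).ncard : ℤ) + k - 1 ≤ I.ncard + 1 := by
    have hs : M.Spanning (insert e₀ I) := by
      rw [Matroid.spanning_iff_closure_eq (Set.insert_subset (hKE he₀) hI.indep.subset_ground),
        Matroid.closure_insert_congr_right hI.closure_eq_closure]
      exact (hspan e₀ he₀).closure_eq
    obtain ⟨B, hB, hBI⟩ := hs.exists_isBase_subset
    rw [← hbase hB]
    exact_mod_cast (Set.ncard_le_ncard hBI (hIf.insert _)).trans (Set.ncard_insert_le _ _)
  have hcard : (G.endSet H).ncard + 1 = V(G).ncard := by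
    -- The rank formula needs a nonempty set. If `H` is empty, the total rank is at most one, which
    -- with `k ≥ 1` leaves a single vertex.
    obtain hHe | hHne := H.eq_empty_or_nonempty
    · have hI0 : I = ∅ := by
        have := hI.subset
        rwa [hHe, Set.subset_empty_iff] at this
      obtain ⟨x, y, hxy⟩ := exists_isLink_of_mem_edgeSet (hKE he₀)
      have hpos := (Set.ncard_pos hV).2 ⟨x, hxy.left_mem⟩
      have hend : G.endSet H = ∅ := by simp [hHe, endSet]
      rw [hI0, Set.ncard_empty] at hge
      rw [hend, Set.ncard_empty]
      omega
    · have h := G.ncard_isBasis_of_forall_mem_isCircuit hk hE hI hHne fun f hf => by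
        have h := hdel.2.1 f
        rw [Matroid.isColoop_iff_forall_notMem_isCircuit hf] at h
        push Not at h
        obtain ⟨C, hC, hfC⟩ := h
        exact ⟨C, hC.subset_ground, (Matroid.delete_isCircuit_iff.1 hC).1, hfC⟩
      omega
  have h1 := Set.ncard_sdiff_add_ncard_of_subset hendV hV
  obtain ⟨v, hv⟩ := Set.ncard_eq_one.1 (show (V(G) \ G.endSet H).ncard = 1 by omega)
  have hvmem : v ∈ V(G) \ G.endSet H := hv ▸ rfl
  refine ⟨v, hv, Set.Subset.antisymm (fun e he => ?_) fun e he => ?_⟩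
  · by_contra hev
    have hend : G.endSet (insert e H) = G.endSet H := by
      refine Set.Subset.antisymm ?_ (G.endSet_mono (Set.subset_insert _ _))
      rintro w ⟨f, rfl | hf, hw⟩
      · by_contra hwH
        have hwv : w ∈ V(G) \ G.endSet H := ⟨hw.vertex_mem, hwH⟩
        rw [hv] at hwv
        exact hev (hwv ▸ hw)
      · exact ⟨f, hf, hw⟩
    -- A base inside `insert e H` would need `|V| + k - 1` edges, but only `|V| - 1` vertices are
    -- met there.
    obtain ⟨B, hB, hBH⟩ := (hspan e he).exists_isBase_subset
    have h2 := KIndep.ncard_le hk hE hB.indep hBH (Set.insert_subset (hKE he) hHE)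
    rw [hend, hbase hB] at h2
    omega
  · by_contra heK
    exact hvmem.2 ⟨e, ⟨he.edge_mem, heK⟩, he⟩

end Graph

/-! ### Reconstruction of the graph -/

theorem mainTheorem8 {α α' β : Type*} (G : Graph α β) (G' : Graph α' β) (k : ℕ) (hk : 1 ≤ k)
    (hV : V(G).Finite) (hE : E(G).Finite) (hV' : V(G').Finite) (hE' : E(G').Finite)
    (hiso' : ∀ v ∈ V(G'), ∃ e, G'.Inc e v)
    (hconn : (G.kCircularMatroid k hk hE).IsConnected)
    (hstars : ∀ S ∈ G.starSet, (G.kCircularMatroid k hk hE).IsNonseparatingCocircuit S)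
    (heq : G.kCircularMatroid k hk hE = G'.kCircularMatroid k hk hE') :
    G.starSet = G'.starSet ∧ G.StronglyIsomorphic G' := by
  have hEE : E(G) = E(G') := congrArg Matroid.E heq
  have hiso : ∀ v ∈ V(G), ∃ e, G.Inc e v :=
    fun v hv => (hstars _ ⟨v, hv, rfl⟩).1.nonempty
  have hcard : V(G').ncard = V(G).ncard := by
    -- Without edges both graphs have no vertices, since neither has isolated ones; otherwise both
    -- vertex counts are read off from the common rank.
    obtain hE0 | hne := E(G).eq_empty_or_nonempty
    · have h1 := Graph.endSet_edgeSet hiso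
      have h2 := Graph.endSet_edgeSet hiso'
      rw [← hEE] at h2
      rw [← h1, ← h2, hE0]
      simp [Graph.endSet]
    · obtain ⟨B, hB⟩ := (G.kCircularMatroid k hk hE).exists_isBase
      have h1 := G.ncard_isBase_of_isConnected hk hE hiso hne hconn hB
      have h2 := G'.ncard_isBase_of_isConnected hk hE' hiso' (hEE ▸ hne) (heq ▸ hconn)
        (heq ▸ hB)
      omega
  have hstar' : ∀ v : V(G), ∃ w : V(G'), G.incidenceSet v = G'.incidenceSet w := by
    rintro ⟨v, hv⟩
    obtain ⟨w, hw, hS⟩ := G'.exists_eq_incidenceSet_of_isNonseparatingCocircuit hk hV' hE' hiso'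
      (heq ▸ hconn) (heq ▸ hstars _ ⟨v, hv, rfl⟩)
    have hwV : w ∈ V(G') \ G'.endSet (E(G') \ G.incidenceSet v) := hw ▸ rfl
    exact ⟨⟨w, hwV.1⟩, hS⟩
  have hinj : ∀ u ∈ V(G), ∀ v ∈ V(G), G.incidenceSet u = G.incidenceSet v → u = v := by
    intro u hu v hv huv
    obtain ⟨w, hw, -⟩ := G.exists_eq_incidenceSet_of_isNonseparatingCocircuit hk hV hE hiso
      hconn (hstars _ ⟨u, hu, rfl⟩)
    -- A vertex with this star is missed by the star's complement, and only one vertex is.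
    have hmem : ∀ x ∈ V(G), G.incidenceSet u = G.incidenceSet x → x = w := by
      intro x hx hux
      have : x ∈ V(G) \ G.endSet (E(G) \ G.incidenceSet u) := by
        refine ⟨hx, ?_⟩
        rintro ⟨e, he, hex⟩
        exact he.2 (hux ▸ hex)
      rwa [hw] at this
    rw [hmem u hu rfl, hmem v hv huv]
  choose ν hν using hstar'
  have hνinj : Function.Injective ν := fun u v huv =>
    Subtype.ext (hinj u u.2 v v.2 (by rw [hν u, hν v, huv]))
  have := hV.to_subtype
  have := hV'.to_subtype
  have hνbij : Function.Bijective ν := by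
    refine hνinj.bijective_of_nat_card_le ?_
    rw [Nat.card_coe_set_eq, Nat.card_coe_set_eq, hcard]
  have hinc : ∀ e (v : V(G)), G.Inc e v ↔ G'.Inc e (ν v) := fun e v =>
    Set.ext_iff.1 (hν v) e
  refine ⟨?_, hEE, Equiv.ofBijective ν hνbij, fun e x y => ?_⟩
  · ext S
    constructor
    · rintro ⟨v, hv, rfl⟩
      exact ⟨ν ⟨v, hv⟩, (ν ⟨v, hv⟩).2, hν ⟨v, hv⟩⟩
    · rintro ⟨w, hw, rfl⟩
      obtain ⟨v, hv⟩ := hνbij.2 ⟨w, hw⟩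
      exact ⟨v, v.2, by rw [hν v, hv]⟩
  · rw [Equiv.ofBijective_apply, Equiv.ofBijective_apply, Graph.isLink_iff_inc,
      Graph.isLink_iff_inc, ← hinc, ← hinc]
    refine and_congr_right fun _ => and_congr_right fun _ => ⟨fun h w hw => ?_, fun h w hw => ?_⟩
    -- Surjectivity of `ν` rules out an end of `e` in `G'` that does not come from `G`.
    · obtain ⟨z, hz⟩ := hνbij.2 ⟨w, hw.vertex_mem⟩
      have hwz : w = ν z := by rw [hz]
      subst hwz
      exact (h z ((hinc e z).2 hw)).imp (fun h => by rw [Subtype.ext h])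
        fun h => by rw [Subtype.ext h]
    · have := h _ ((hinc e ⟨w, hw.vertex_mem⟩).1 hw)
      exact this.imp (fun h => congrArg Subtype.val (hνinj (Subtype.ext h)))
        fun h => congrArg Subtype.val (hνinj (Subtype.ext h))
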